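/- **Proposition.** Identify $\mathbb R^4$ with $\mathbb C^2$ by $z^1=x^1+ix^2$, $z^2=x^3+ix^4$, with symplectic form $dx^1\wedge dx^2+dx^3\wedge dx^4$. For a lattice $\Lambda\subset\mathbb C$, a *solution* on $\mathbb C/\Lambda$ is a map $X:\mathbb C/\Lambda\to\mathbb R^4$ with a harmonic function $\beta:\mathbb C\to\mathbb R$ (a lifted Lagrangian angle) such that $e^{i\beta}$ is $\Lambda$-periodic and the lift of $X$ to $\mathbb C$ (again written $X$, with $z=x+iy$) is smooth, weakly conformal ($|X_x|=|X_y|$, $\langle X_x,X_y\rangle=0$), Lagrangian ($\omega(X_x,X_y)=0$, where $\omega$ is the symplectic form), and satisfies $dz^1\wedge dz^2(X_x,X_y)=|X_x|^2e^{i\beta}$; that is, $X$ is a weakly conformal Hamiltonian stationary Lagrangian map with Lagrangian angle $\beta$. It is *truly periodic* if $e^{i\beta/2}$ is $\Lambda$-periodic (equivalently, $\beta(z)=2\pi\langle\beta_0,z\rangle+\text{const}$ with $\beta_0/2$ in the dual lattice $\Lambda^*$). Let $\mathbb C/\Gamma$ be a square torus, $\Gamma=w(\mathbb Z\oplus i\mathbb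 Z)$ with $w\in\mathbb C\setminus\{0\}$, let $(X,\beta)$ be a truly periodic solution on $\mathbb C/\Gamma$, and let $$\Delta_0=w\left(\tfrac{1-i}{2}\mathbb Z\oplus\tfrac{1+i}{2}\mathbb Z\right).$$ Then $X$ is $\Delta_0$-periodic. Moreover $\Delta_0\supset\Gamma$ is again a square lattice, the canonical projection $\pi:\mathbb C/\Gamma\to\mathbb C/\Delta_0$ is a twofold covering map, and $X=Y\circ\pi$ for a solution $Y$ on $\mathbb C/\Delta_0$ with the same $\beta$. Thus $X$ is a twofold cover of a solution on a smaller square torus. -/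

import Mathlib

open scoped ContDiff

noncomputable section

namespace HSL

/-- The ambient Euclidean space `ℝ⁴`, with coordinates `(x¹, x², x³, x⁴)` (indexed by `0, 1, 2, 3`).
It is identified with `ℂ²` through `z¹ = x¹ + i x²`, `z² = x³ + i x⁴`. -/
abbrev E4 : Type := EuclideanSpace ℝ (Fin 4)

/-- The symplectic form `ω = dx¹ ∧ dx² + dx³ ∧ dx⁴`. -/
def symplectic (v w : E4) : ℝ :=
  (v 0 * w 1 - v 1 * w 0) + (v 2 * w 3 - v 3 * w 2)

/-- The complex coordinate `z¹ = x¹ + i x²`. -/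
def zOne (v : E4) : ℂ := (v 0 : ℂ) + Complex.I * (v 1 : ℂ)

/-- The complex coordinate `z² = x³ + i x⁴`. -/
def zTwo (v : E4) : ℂ := (v 2 : ℂ) + Complex.I * (v 3 : ℂ)

/-- The complex two-form `dz¹ ∧ dz²`. -/
def volForm (v w : E4) : ℂ := zOne v * zTwo w - zTwo v * zOne w

/-- The partial derivative `∂f/∂x`, where `z = x + i y`. -/
def partialX (f : ℂ → E4) (z : ℂ) : E4 := fderiv ℝ f z 1

/-- The partial derivative `∂f/∂y`, where `z = x + i y`. -/
def partialY (f : ℂ → E4) (z : ℂ) : E4 := fderiv ℝ f z Complex.I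

/-- A smooth map `f : ℂ → ℝ⁴` is a weakly conformal Hamiltonian stationary Lagrangian map with
(lifted) Lagrangian angle `β : ℂ → ℝ`.  Where `f` is an immersion, `∂f/∂x = r e₁`, `∂f/∂y = r e₃`
with `(e₁, e₃)` orthonormal and `r > 0`, and `angle` says `dz¹ ∧ dz² (e₁, e₃) = exp (i β)`;
Hamiltonian stationarity is the harmonicity of the Lagrangian angle. -/
structure IsHamStatLagrangian (f : ℂ → E4) (β : ℂ → ℝ) : Prop where
  smooth : ContDiff ℝ ∞ f
  conformal_norm : ∀ z, ‖partialX f z‖ = ‖partialY f z‖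
  conformal_inner : ∀ z, inner ℝ (partialX f z) (partialY f z) = 0
  lagrangian : ∀ z, symplectic (partialX f z) (partialY f z) = 0
  angle : ∀ z, volForm (partialX f z) (partialY f z) =
    ((‖partialX f z‖ ^ 2 : ℝ) : ℂ) * Complex.exp (Complex.I * (β z : ℂ))
  harmonic : InnerProductSpace.HarmonicOnNhd β Set.univ

/-- The lift to the universal cover `ℂ` of a map defined on `ℂ / Γ`. -/
def lift {Γ : AddSubgroup ℂ} (X : ℂ ⧸ Γ → E4) (z : ℂ) : E4 := X (QuotientAddGroup.mk z)

/-- `X : ℂ / Γ → ℝ⁴` is a weakly conformal Hamiltonian stationary Lagrangian map whose Lagrangian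
angle is the class modulo `2π` of `β`; as a map to `ℝ / 2πℤ` the angle is defined on `ℂ / Γ`. -/
structure IsSolution (Γ : AddSubgroup ℂ) (X : ℂ ⧸ Γ → E4) (β : ℂ → ℝ) : Prop where
  hamStat : IsHamStatLagrangian (lift X) β
  angle_periodic : ∀ γ ∈ Γ, ∀ z : ℂ,
    Complex.exp (Complex.I * (β (z + γ) : ℂ)) = Complex.exp (Complex.I * (β z : ℂ))

/-- The rotation part of the spinor lift, which is multiplication by `exp (i β / 2)` on
`ℂ² = ℝ⁴`, is `Γ`-periodic. -/
def TrulyPeriodic (Γ : AddSubgroup ℂ) (β : ℂ → ℝ) : Prop :=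
  ∀ γ ∈ Γ, ∀ z : ℂ,
    Complex.exp (Complex.I * (β (z + γ) : ℂ) / 2) = Complex.exp (Complex.I * (β z : ℂ) / 2)

/-- The subgroup `a ℤ + b ℤ` of `ℂ`. -/
def spanZ (a b : ℂ) : AddSubgroup ℂ := AddSubgroup.closure {a, b}

/-- `Γ = w (ℤ ⊕ i ℤ)` for some `w ≠ 0`, i.e. `ℂ / Γ` is a square torus. -/
def IsSquareLattice (Γ : AddSubgroup ℂ) : Prop :=
  ∃ w : ℂ, w ≠ 0 ∧ Γ = spanZ w (Complex.I * w)

/-- The canonical projection `ℂ / Γ → ℂ / Δ` for `Γ ≤ Δ`. -/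
def torusProj {Γ Δ : AddSubgroup ℂ} (h : Γ ≤ Δ) : ℂ ⧸ Γ → ℂ ⧸ Δ :=
  QuotientAddGroup.map Γ Δ (AddMonoidHom.id ℂ) h

/-- A covering map all of whose fibres have exactly two points. -/
structure IsTwofoldCover {A B : Type*} [TopologicalSpace A] [TopologicalSpace B]
    (p : A → B) : Prop where
  isCoveringMap : IsCoveringMap p
  fibre_card : ∀ b : B, (p ⁻¹' {b}).ncard = 2

end HSL

end

/-! Put `A` $= z^1\circ X$, `C` $= \overline{z^2}\circ X$, $E = e^{i\beta}$. Weak conformality and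
the angle condition force equality in $|dz^1\wedge dz^2(u,v)|\le|u||v|$, so $X_y$ is determined by
$X_x$, and $X$ solves the linear system $A_x = E\,C_y$, $A_y = -E\,C_x$
(`IsHamStatLagrangian.system`). True periodicity and Liouville's theorem make $\beta$ affine
(`exists_affine_of_trulyPeriodic`). After rescaling by $w$, $E$ is a constant times the character of
frequency $(2p,2q)$, with both entries even. On Fourier coefficients the system reads $m\,a_{m,n} =
\kappa(n-2q)c$ and $n\,a_{m,n} = -\kappa(m-2p)c$ with the same $c = c_{m-2p,n-2q}$. Eliminating $c$
shows that $a_{m,n}\ne0$ only if $m(m-2p)+n(n-2q)=0$, which makes $m+n$ even. Translation by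
$(1+i)/2$ multiplies the mode $(m,n)$ by $(-1)^{m+n}$, hence fixes `A`; by a symmetry of the system
it also fixes `C` (`periodic_half_of_system`). Finally $\Delta_0 =
\Gamma\cup(\Gamma+\tfrac{1+i}{2}w)$, so the projection is a quotient by a group of order two. -/

namespace HSL

open MeasureTheory

/-! ### Fourier coefficients on $\mathbb R/\mathbb Z$ -/

/-- The character `t ↦ exp (2 π i n t)` of `ℝ / ℤ`. -/
noncomputable def char (n : ℤ) (t : ℝ) : ℂ := Complex.exp (2 * Real.pi * Complex.I * n * t)

theorem char_add_index (m n : ℤ) (t : ℝ) : char (m + n) t = char m t * char n t := by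
  rw [char, char, char, ← Complex.exp_add]; push_cast; ring_nf

theorem char_add_one (n : ℤ) (t : ℝ) : char n (t + 1) = char n t := by
  rw [char, char]
  have : (2 * Real.pi * Complex.I * n * ((t + 1 : ℝ) : ℂ)) =
      2 * Real.pi * Complex.I * n * t + n * (2 * Real.pi * Complex.I) := by push_cast; ring
  rw [this, Complex.exp_add, Complex.exp_int_mul_two_pi_mul_I, mul_one]

theorem char_add_half (n : ℤ) (t : ℝ) : char n (t + 1 / 2) = (-1) ^ n * char n t := by
  rw [char, char]
  have : (2 * Real.pi * Complex.I * n * ((t + 1 / 2 : ℝ) : ℂ)) =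
      n * (Real.pi * Complex.I) + 2 * Real.pi * Complex.I * n * t := by push_cast; ring
  rw [this, Complex.exp_add, Complex.exp_int_mul, Complex.exp_pi_mul_I]

theorem hasDerivAt_char (n : ℤ) (t : ℝ) :
    HasDerivAt (char n) (2 * Real.pi * Complex.I * n * char n t) t := by
  have h : HasDerivAt (fun t : ℝ => 2 * Real.pi * Complex.I * n * (t : ℂ))
      (2 * Real.pi * Complex.I * n * 1) t := (Complex.ofRealCLM.hasDerivAt).const_mul _
  exact h.cexp.congr_deriv (by rw [char]; ring)

theorem continuous_char (n : ℤ) : Continuous (char n) :=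
  continuous_iff_continuousAt.2 fun t => (hasDerivAt_char n t).continuousAt

@[fun_prop]
theorem continuous_char_comp {T : Type*} [TopologicalSpace T] (n : ℤ) {f : T → ℝ}
    (hf : Continuous f) : Continuous fun t => char n (f t) := (continuous_char n).comp hf

/-- Integration by parts for the Fourier coefficients of a `1`-periodic function. -/
theorem integral_char_mul_deriv {f f' : ℝ → ℂ} (hf : ∀ t, HasDerivAt f (f' t) t)
    (hf' : Continuous f') (h1 : f 1 = f 0) (n : ℤ) :
    ∫ t in (0 : ℝ)..1, char (-n) t * f' t =
      2 * Real.pi * Complex.I * n * ∫ t in (0 : ℝ)..1, char (-n) t * f t := by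
  have hc : Continuous f := continuous_iff_continuousAt.2 fun t => (hf t).continuousAt
  rw [intervalIntegral.integral_mul_deriv_eq_deriv_mul (fun t _ => hasDerivAt_char (-n) t)
    (fun t _ => hf t) ((by fun_prop : Continuous _).intervalIntegrable _ _)
    (hf'.intervalIntegrable _ _), h1,
    ← intervalIntegral.integral_const_mul]
  have : char (-n) 1 = char (-n) 0 := by simpa using char_add_one (-n) 0
  rw [this, sub_self, zero_sub, ← intervalIntegral.integral_neg]
  congr 1 with t
  push_cast; ring

/-- A continuous `1`-periodic function is determined by its Fourier coefficients. -/
theorem eq_of_integral_char_mul_eq {f g : ℝ → ℂ} (hf : Continuous f) (hg : Continuous g)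
    (hf1 : f.Periodic 1) (hg1 : g.Periodic 1)
    (h : ∀ n : ℤ, ∫ t in (0 : ℝ)..1, char n t * f t = ∫ t in (0 : ℝ)..1, char n t * g t) :
    f = g := by
  have hd1 : (f - g).Periodic 1 := fun t => by simp [hf1 t, hg1 t]
  let F : C(AddCircle (1 : ℝ), ℂ) := ⟨hd1.lift, (hf.sub hg).quotient_liftOn' _⟩
  have h0 : ∀ n, fourierCoeff F n = 0 := by
    intro n
    rw [fourierCoeff_eq_intervalIntegral _ n 0]
    have : ∀ t : ℝ, @fourier 1 (-n) t • F t = char (-n) t * f t - char (-n) t * g t := by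
      intro t
      have : F t = f t - g t := rfl
      rw [this, fourier_coe_apply, smul_eq_mul, ← mul_sub, char]
      congr 2
      simp
    simp_rw [this]
    rw [intervalIntegral.integral_sub ((by fun_prop : Continuous _).intervalIntegrable _ _)
      ((by fun_prop : Continuous _).intervalIntegrable _ _), zero_add, h, sub_self, smul_zero]
  -- Vanishing coefficients are summable, so the Fourier series converges pointwise to `F`, which is
  -- therefore zero.
  have hs : Summable (fourierCoeff F) := by
    rw [show fourierCoeff F = 0 from funext h0]; exact summable_zero
  funext t
  have := has_pointwise_sum_fourier_series_of_summable hs (t : AddCircle (1 : ℝ))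
  simp only [h0, zero_smul] at this
  exact sub_eq_zero.1 (this.unique hasSum_zero)

/-! ### Fourier coefficients on $\mathbb C/(\mathbb Z\oplus i\mathbb Z)$ -/

/-- The Fourier coefficient of index `(m, n)` of a function on `ℂ` that is periodic with respect
to `ℤ ⊕ i ℤ`. -/
noncomputable def doubleCoeff (g : ℂ → ℂ) (m n : ℤ) : ℂ :=
  ∫ t in (0 : ℝ)..1, char (-n) t * ∫ s in (0 : ℝ)..1, char (-m) s * g (s + t * Complex.I)

/-- Fubini makes the imaginary direction the inner integral, so that one-variable integration by
parts also handles $\partial/\partial y$. -/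
theorem doubleCoeff_symm {g : ℂ → ℂ} (hg : Continuous g) (m n : ℤ) :
    doubleCoeff g m n = ∫ s in (0 : ℝ)..1,
      char (-m) s * ∫ t in (0 : ℝ)..1, char (-n) t * g (s + t * Complex.I) := by
  simp_rw [doubleCoeff, ← intervalIntegral.integral_const_mul]
  rw [intervalIntegral_intervalIntegral_swap]
  · simp_rw [mul_left_comm]
  · refine IntegrableOn.mono_set (t := Set.Icc 0 1 ×ˢ Set.Icc 0 1) ?_ ?_
    · refine ContinuousOn.integrableOn_compact (isCompact_Icc.prod isCompact_Icc) ?_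
      refine Continuous.continuousOn ?_
      unfold Function.uncurry
      fun_prop
    · rw [Set.uIoc_of_le zero_le_one]
      exact Set.prod_mono Set.Ioc_subset_Icc_self Set.Ioc_subset_Icc_self

theorem hasDerivAt_comp_re {g : ℂ → ℂ} (hg : ContDiff ℝ 1 g) (s t : ℝ) :
    HasDerivAt (fun s : ℝ => g (s + t * Complex.I)) (fderiv ℝ g (s + t * Complex.I) 1) s := by
  have h : HasDerivAt (fun s : ℝ => (s : ℂ) + t * Complex.I) 1 s :=
    (Complex.ofRealCLM.hasDerivAt).add_const _
  exact ((hg.differentiable one_ne_zero _).hasFDerivAt).comp_hasDerivAt s h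

theorem hasDerivAt_comp_im {g : ℂ → ℂ} (hg : ContDiff ℝ 1 g) (s t : ℝ) :
    HasDerivAt (fun t : ℝ => g (s + t * Complex.I))
      (fderiv ℝ g (s + t * Complex.I) Complex.I) t := by
  have h : HasDerivAt (fun t : ℝ => (s : ℂ) + t * Complex.I) (1 * Complex.I) t :=
    ((Complex.ofRealCLM.hasDerivAt).mul_const _).const_add _
  rw [one_mul] at h
  exact ((hg.differentiable one_ne_zero _).hasFDerivAt).comp_hasDerivAt t h

theorem doubleCoeff_fderiv_one {g : ℂ → ℂ} (hg : ContDiff ℝ 1 g) (h1 : g.Periodic 1) (m n : ℤ) :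
    doubleCoeff (fun z => fderiv ℝ g z 1) m n =
      2 * Real.pi * Complex.I * m * doubleCoeff g m n := by
  have hc : Continuous (fun z => fderiv ℝ g z 1) :=
    (hg.continuous_fderiv one_ne_zero).clm_apply continuous_const
  rw [doubleCoeff, doubleCoeff, ← intervalIntegral.integral_const_mul]
  congr 1 with t
  rw [integral_char_mul_deriv (fun s => hasDerivAt_comp_re hg s t)
    (hc.comp (by fun_prop : Continuous fun s : ℝ => (s : ℂ) + t * Complex.I))]
  · ring
  · have := h1 (t * Complex.I)
    simpa [add_comm] using this

theorem doubleCoeff_fderiv_I {g : ℂ → ℂ} (hg : ContDiff ℝ 1 g) (hI : g.Periodic Complex.I)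
    (m n : ℤ) :
    doubleCoeff (fun z => fderiv ℝ g z Complex.I) m n =
      2 * Real.pi * Complex.I * n * doubleCoeff g m n := by
  have hc : Continuous (fun z => fderiv ℝ g z Complex.I) :=
    (hg.continuous_fderiv one_ne_zero).clm_apply continuous_const
  rw [doubleCoeff_symm hc, doubleCoeff_symm hg.continuous, ← intervalIntegral.integral_const_mul]
  congr 1 with s
  rw [integral_char_mul_deriv (fun t => hasDerivAt_comp_im hg s t)
    (hc.comp (by fun_prop : Continuous fun t : ℝ => (s : ℂ) + t * Complex.I))]
  · ring
  · have := hI s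
    simpa using this

/-- A character factor only shifts the frequency; this makes the system with coefficient $E$
algebraic, mode by mode. -/
theorem doubleCoeff_char_mul (g : ℂ → ℂ) (κ : ℂ) (k l m n : ℤ) :
    doubleCoeff (fun z => κ * char k z.re * char l z.im * g z) m n =
      κ * doubleCoeff g (m - k) (n - l) := by
  simp_rw [doubleCoeff, ← intervalIntegral.integral_const_mul]
  congr 1 with t
  congr 1 with s
  rw [show -(m - k) = -m + k by ring, show -(n - l) = -n + l by ring, char_add_index,
    char_add_index]
  simp
  ring

theorem continuous_integral_char_mul {g : ℂ → ℂ} (hg : Continuous g) (m : ℤ) :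
    Continuous fun t : ℝ => ∫ s in (0 : ℝ)..1, char m s * g (s + t * Complex.I) := by
  refine intervalIntegral.continuous_parametric_intervalIntegral_of_continuous' ?_ 0 1
  unfold Function.uncurry
  fun_prop

theorem periodic_re {g : ℂ → ℂ} (h1 : g.Periodic 1) (t : ℝ) :
    Function.Periodic (fun s : ℝ => g (s + t * Complex.I)) 1 := fun s => by
  have := h1 (s + t * Complex.I)
  rw [add_right_comm] at this
  simpa using this

theorem periodic_im {g : ℂ → ℂ} (hI : g.Periodic Complex.I) (s : ℝ) :
    Function.Periodic (fun t : ℝ => g (s + t * Complex.I)) 1 := fun t => by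
  have := hI (s + t * Complex.I)
  rw [add_assoc] at this
  simpa [add_mul] using this

theorem periodic_integral_char_mul {g : ℂ → ℂ} (hI : g.Periodic Complex.I) (m : ℤ) :
    Function.Periodic
      (fun t : ℝ => ∫ s in (0 : ℝ)..1, char m s * g (s + t * Complex.I)) 1 := fun t =>
  intervalIntegral.integral_congr fun s _ => congrArg (char m s * ·) (periodic_im hI s t)

/-- A continuous doubly periodic function is determined by its Fourier coefficients. -/
theorem eq_of_doubleCoeff_eq {f g : ℂ → ℂ} (hf : Continuous f) (hg : Continuous g)
    (hf1 : f.Periodic 1) (hfI : f.Periodic Complex.I)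
    (hg1 : g.Periodic 1) (hgI : g.Periodic Complex.I)
    (h : ∀ m n, doubleCoeff f m n = doubleCoeff g m n) : f = g := by
  have key : ∀ m : ℤ, (fun t : ℝ => ∫ s in (0 : ℝ)..1, char m s * f (s + t * Complex.I)) =
      fun t : ℝ => ∫ s in (0 : ℝ)..1, char m s * g (s + t * Complex.I) := by
    intro m
    refine eq_of_integral_char_mul_eq (continuous_integral_char_mul hf m)
      (continuous_integral_char_mul hg m) ?_ ?_ fun n => ?_
    · exact periodic_integral_char_mul hfI m
    · exact periodic_integral_char_mul hgI m
    · simpa [doubleCoeff] using h (-m) (-n)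
  funext z
  have := eq_of_integral_char_mul_eq
    (hf.comp (by fun_prop : Continuous fun s : ℝ => (s : ℂ) + z.im * Complex.I))
    (hg.comp (by fun_prop : Continuous fun s : ℝ => (s : ℂ) + z.im * Complex.I))
    (periodic_re hf1 z.im) (periodic_re hg1 z.im) fun m => congrFun (key m) z.im
  simpa using congrFun this z.re

theorem integral_char_mul_add_half {f : ℝ → ℂ} (hf : f.Periodic 1) (n : ℤ) :
    ∫ t in (0 : ℝ)..1, char n t * f (t + 1 / 2) =
      (-1) ^ n * ∫ t in (0 : ℝ)..1, char n t * f t := by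
  have hp : Function.Periodic (fun t => char n t * f t) 1 := fun t => by
    simp only [char_add_one, hf t]
  have h2 : ((-1 : ℂ) ^ n) * (-1) ^ n = 1 := by
    rw [← mul_zpow]; simp
  have : ∀ t, char n t * f (t + 1 / 2) =
      (-1) ^ n * (char n (t + 1 / 2) * f (t + 1 / 2)) := fun t => by
    rw [char_add_half, ← mul_assoc, ← mul_assoc, h2, one_mul]
  simp_rw [this]
  rw [intervalIntegral.integral_const_mul,
    intervalIntegral.integral_comp_add_right (fun t => char n t * f t), zero_add,
    add_comm (1 : ℝ), hp.intervalIntegral_add_eq (1 / 2) 0, zero_add]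

/-- Each half-period shift contributes its own sign. Invariance under the half diagonal thus amounts
to the vanishing of all modes with $m+n$ odd. -/
theorem doubleCoeff_comp_add_half {g : ℂ → ℂ} (h1 : g.Periodic 1) (hI : g.Periodic Complex.I)
    (m n : ℤ) :
    doubleCoeff (fun z => g (z + (1 + Complex.I) / 2)) m n =
      (-1) ^ (m + n) * doubleCoeff g m n := by
  have hs : ∀ t : ℝ, ∫ s in (0 : ℝ)..1,
      char (-m) s * g (s + t * Complex.I + (1 + Complex.I) / 2) =
      (-1) ^ (-m) * ∫ s in (0 : ℝ)..1, char (-m) s * g (s + (t + 1 / 2 : ℝ) * Complex.I) := by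
    intro t
    rw [← integral_char_mul_add_half (periodic_re h1 (t + 1 / 2))]
    congr 1 with s
    congr 2
    push_cast; ring
  have ht : Function.Periodic
      (fun t : ℝ => ∫ s in (0 : ℝ)..1, char (-m) s * g (s + t * Complex.I)) 1 :=
    periodic_integral_char_mul hI (-m)
  simp_rw [doubleCoeff, hs, mul_left_comm _ ((-1 : ℂ) ^ (-m))]
  rw [intervalIntegral.integral_const_mul, integral_char_mul_add_half ht, ← mul_assoc,
    ← zpow_add₀ (by norm_num), ← neg_add, zpow_neg, ← inv_zpow]
  norm_num

/-! ### The first order system in frequency space -/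

/-- The Fourier frequencies `(m, n)` of a doubly periodic solution of the first order system lie
on the circle with diameter from `0` to `(2 p, 2 q)`, so that `m + n` is even. -/
theorem periodic_half_of_system {A C E : ℂ → ℂ} (hA : ContDiff ℝ 1 A) (hC : ContDiff ℝ 1 C)
    (hA1 : A.Periodic 1) (hAI : A.Periodic Complex.I)
    (hC1 : C.Periodic 1) (hCI : C.Periodic Complex.I) (κ : ℂ) (p q : ℤ)
    (hE : ∀ z, E z = κ * char (2 * p) z.re * char (2 * q) z.im)
    (h1 : ∀ z, fderiv ℝ A z 1 = E z * fderiv ℝ C z Complex.I)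
    (h2 : ∀ z, fderiv ℝ A z Complex.I = -(E z * fderiv ℝ C z 1)) :
    A.Periodic ((1 + Complex.I) / 2) := by
  have hpi : (2 * Real.pi * Complex.I : ℂ) ≠ 0 := Complex.two_pi_I_ne_zero
  have e1 : ∀ m n : ℤ, (m : ℂ) * doubleCoeff A m n =
      κ * ((n - 2 * q : ℤ) * doubleCoeff C (m - 2 * p) (n - 2 * q)) := by
    intro m n
    have := doubleCoeff_fderiv_one hA hA1 m n
    simp_rw [h1, hE] at this
    rw [doubleCoeff_char_mul, doubleCoeff_fderiv_I hC hCI] at this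
    refine mul_left_cancel₀ hpi ?_
    linear_combination -this
  have e2 : ∀ m n : ℤ, (n : ℂ) * doubleCoeff A m n =
      -κ * ((m - 2 * p : ℤ) * doubleCoeff C (m - 2 * p) (n - 2 * q)) := by
    intro m n
    have := doubleCoeff_fderiv_I hA hAI m n
    simp_rw [h2, hE, ← neg_mul] at this
    rw [doubleCoeff_char_mul, doubleCoeff_fderiv_one hC hC1] at this
    refine mul_left_cancel₀ hpi ?_
    linear_combination -this
  have e3 : ∀ m n : ℤ, ¬ Even (m + n) → doubleCoeff A m n = 0 := by
    intro m n hmn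
    have h3 : ((m * (m - 2 * p) + n * (n - 2 * q) : ℤ) : ℂ) * doubleCoeff A m n = 0 := by
      have a := e1 m n
      have b := e2 m n
      push_cast at a b ⊢
      -- These multipliers make the two `C` terms cancel.
      linear_combination (m - 2 * p : ℂ) * a + (n - 2 * q : ℂ) * b
    refine (mul_eq_zero.1 h3).resolve_left fun h => hmn ?_
    have h4 : m * (m - 2 * p) + n * (n - 2 * q) = 0 := by exact_mod_cast h
    -- By `h4`, $m^2+n^2 = 2(mp+nq)$, so $(m+n)^2 = 2(mp+nq+mn)$.
    have h5 : Even ((m + n) * (m + n)) := ⟨m * p + n * q + m * n, by linear_combination h4⟩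
    simpa [Int.even_mul] using h5
  have hp : ∀ c : ℂ, A.Periodic c → (fun z => A (z + (1 + Complex.I) / 2)).Periodic c :=
    fun c hc z => by simp only [add_right_comm z c, hc _]
  refine fun z => congrFun (eq_of_doubleCoeff_eq (f := fun z => A (z + (1 + Complex.I) / 2))
    (g := A) (hA.continuous.comp (by fun_prop)) hA.continuous (hp _ hA1) (hp _ hAI) hA1 hAI ?_) z
  intro m n
  rw [doubleCoeff_comp_add_half hA1 hAI]
  by_cases hmn : Even (m + n)
  · rw [hmn.neg_one_zpow, one_mul]
  · rw [e3 m n hmn, mul_zero]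

theorem mem_spanZ {a b z : ℂ} : z ∈ spanZ a b ↔ ∃ m n : ℤ, z = m * a + n * b := by
  simp only [spanZ, AddSubgroup.mem_closure_pair, zsmul_eq_mul, eq_comm]

/-! ### From the angle condition to the linear system -/

/-- Equality case of the Cauchy-Schwarz inequality for `dz¹ ∧ dz²`. -/
theorem zOne_zTwo_of_volForm_eq {u v : E4} {E : ℂ} (hE : Complex.normSq E = 1)
    (hn : ‖u‖ = ‖v‖) (h : volForm u v = ((‖u‖ ^ 2 : ℝ) : ℂ) * E) :
    zOne v = -(E * starRingEnd ℂ (zTwo u)) ∧ zTwo v = E * starRingEnd ℂ (zOne u) := by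
  have hu := EuclideanSpace.real_norm_sq_eq u
  have hv := EuclideanSpace.real_norm_sq_eq v
  rw [← hn] at hv
  rw [Fin.sum_univ_four] at hu hv
  have hre := congrArg Complex.re h
  have him := congrArg Complex.im h
  rw [Complex.re_ofReal_mul] at hre
  rw [Complex.im_ofReal_mul] at him
  rw [Complex.normSq_apply] at hE
  simp only [volForm, zOne, zTwo, Complex.sub_re, Complex.sub_im, Complex.mul_re, Complex.mul_im,
    Complex.add_re, Complex.add_im, Complex.ofReal_re, Complex.ofReal_im, Complex.I_re,
    Complex.I_im] at hre him
  -- The sum expands to $|u|^2+|v|^2-2\,\mathrm{Re}(\overline E\,dz^1\wedge dz^2(u,v)) =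
  -- 2|u|^2-2|u|^2|E|^2 = 0$.
  have hsum : Complex.normSq (zOne v + E * starRingEnd ℂ (zTwo u)) +
      Complex.normSq (zTwo v - E * starRingEnd ℂ (zOne u)) = 0 := by
    simp only [Complex.normSq_apply, zOne, zTwo, map_add, map_mul, Complex.conj_ofReal,
      Complex.conj_I, Complex.sub_re, Complex.sub_im, Complex.mul_re, Complex.mul_im,
      Complex.add_re, Complex.add_im, Complex.ofReal_re, Complex.ofReal_im, Complex.I_re,
      Complex.I_im, Complex.neg_re, Complex.neg_im]
    linear_combination -hv - hu - 2 * E.re * hre - 2 * E.im * him +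
      (u 0 ^ 2 + u 1 ^ 2 + u 2 ^ 2 + u 3 ^ 2 - 2 * ‖u‖ ^ 2) * hE
  have h1 := Complex.normSq_nonneg (zOne v + E * starRingEnd ℂ (zTwo u))
  have h2 := Complex.normSq_nonneg (zTwo v - E * starRingEnd ℂ (zOne u))
  constructor
  · exact eq_neg_of_add_eq_zero_left (Complex.normSq_eq_zero.1 (by linarith))
  · exact sub_eq_zero.1 (Complex.normSq_eq_zero.1 (by linarith))

/-- The coordinate `z¹` as a continuous real linear map. -/
noncomputable def zOneCLM : E4 →L[ℝ] ℂ :=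
  LinearMap.toContinuousLinearMap
    { toFun := zOne
      map_add' := fun v w => by simp [zOne]; ring
      map_smul' := fun c v => by simp [zOne]; ring }

/-- The conjugate of the coordinate `z²` as a continuous real linear map. -/
noncomputable def conjZTwoCLM : E4 →L[ℝ] ℂ :=
  LinearMap.toContinuousLinearMap
    { toFun := fun v => starRingEnd ℂ (zTwo v)
      map_add' := fun v w => by simp [zTwo]; ring
      map_smul' := fun c v => by simp [zTwo]; ring }

theorem zOneCLM_apply (v : E4) : zOneCLM v = zOne v := rfl

theorem conjZTwoCLM_apply (v : E4) : conjZTwoCLM v = starRingEnd ℂ (zTwo v) := rfl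

theorem E4_ext {v w : E4} (h1 : zOneCLM v = zOneCLM w) (h2 : conjZTwoCLM v = conjZTwoCLM w) :
    v = w := by
  rw [zOneCLM_apply, zOneCLM_apply] at h1
  rw [conjZTwoCLM_apply, conjZTwoCLM_apply] at h2
  replace h2 := (starRingEnd ℂ).injective h2
  have a := congrArg Complex.re h1
  have b := congrArg Complex.im h1
  have c := congrArg Complex.re h2
  have d := congrArg Complex.im h2
  simp [zOne, zTwo] at a b c d
  ext i
  fin_cases i <;> assumption

theorem exp_I_mul_mul_conj (b : ℝ) : Complex.exp (Complex.I * b) *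
    starRingEnd ℂ (Complex.exp (Complex.I * b)) = 1 := by
  rw [Complex.mul_conj, Complex.normSq_eq_norm_sq, mul_comm, Complex.norm_exp_ofReal_mul_I]
  simp

/-- The Hamiltonian stationary condition as a first order linear system for `z¹` and the conjugate
of `z²`. -/
theorem IsHamStatLagrangian.system {f : ℂ → E4} {β : ℂ → ℝ} (h : IsHamStatLagrangian f β) (z : ℂ) :
    zOneCLM (partialX f z) =
      Complex.exp (Complex.I * β z) * conjZTwoCLM (partialY f z) ∧
    zOneCLM (partialY f z) =
      -(Complex.exp (Complex.I * β z) * conjZTwoCLM (partialX f z)) := by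
  have hE := exp_I_mul_mul_conj (β z)
  have hE1 : Complex.normSq (Complex.exp (Complex.I * β z)) = 1 := by
    rw [Complex.mul_conj] at hE; exact_mod_cast hE
  obtain ⟨h1, h2⟩ := zOne_zTwo_of_volForm_eq hE1 (h.conformal_norm z) (h.angle z)
  simp only [zOneCLM_apply, conjZTwoCLM_apply]
  refine ⟨?_, h1⟩
  rw [h2, map_mul, Complex.conj_conj, ← mul_assoc, hE, one_mul]

/-- The first order system is conformally invariant. -/
theorem apply_eq_mul_apply_mul_I {L M : ℂ →L[ℝ] ℂ} {E : ℂ} (h1 : L 1 = E * M Complex.I)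
    (h2 : L Complex.I = -(E * M 1)) (w : ℂ) : L w = E * M (w * Complex.I) := by
  have hw : w = w.re • (1 : ℂ) + w.im • Complex.I := by simp
  have hw' : w * Complex.I = w.re • Complex.I - w.im • (1 : ℂ) := by
    conv_lhs => rw [hw]
    rw [add_mul, smul_mul_assoc, smul_mul_assoc, Complex.I_mul_I, one_mul, smul_neg, sub_eq_add_neg]
  rw [hw', map_sub, map_smul, map_smul]
  conv_lhs => rw [hw, map_add, map_smul, map_smul, h1, h2]
  simp only [Complex.real_smul]
  ring

theorem fderiv_clm_comp_mul_left {f : ℂ → E4} (hf : Differentiable ℝ f) (L : E4 →L[ℝ] ℂ)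
    (w z h : ℂ) : fderiv ℝ (fun z => L (f (w * z))) z h = (L ∘L fderiv ℝ f (w * z)) (w * h) := by
  have h1 : HasFDerivAt (fun z : ℂ => w * z) (ContinuousLinearMap.mul ℝ ℂ w) z :=
    (ContinuousLinearMap.mul ℝ ℂ w).hasFDerivAt
  have h2 := (L.hasFDerivAt.comp (w * z) (hf (w * z)).hasFDerivAt).comp z h1
  exact congrArg (fun T : ℂ →L[ℝ] ℂ => T h) h2.fderiv

/-! ### The lifted angle is affine -/

/-- Pointwise the increment of $\beta/2$ lies in $2\pi\mathbb Z$; the integer depends continuously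
on `z`, hence is constant because $\mathbb C$ is connected. -/
theorem exists_int_of_exp_half_eq {β : ℂ → ℝ} (hβ : Continuous β) {γ : ℂ}
    (h : ∀ z, Complex.exp (Complex.I * (β (z + γ) : ℂ) / 2) =
      Complex.exp (Complex.I * (β z : ℂ) / 2)) :
    ∃ n : ℤ, ∀ z, β (z + γ) = β z + 4 * Real.pi * n := by
  have key : ∀ z, ∃ n : ℤ, β (z + γ) = β z + 4 * Real.pi * n := by
    intro z
    obtain ⟨n, hn⟩ := Complex.exp_eq_exp_iff_exists_int.1 (h z)
    refine ⟨n, ?_⟩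
    have : (β (z + γ) : ℂ) = β z + 4 * Real.pi * n := by
      refine mul_left_cancel₀ Complex.I_ne_zero ?_
      linear_combination 2 * hn
    exact_mod_cast this
  choose n hn using key
  have hc : Continuous n := by
    rw [Int.isClosedEmbedding_coe_real.isInducing.continuous_iff]
    have : ((↑) : ℤ → ℝ) ∘ n = fun z => (β (z + γ) - β z) / (4 * Real.pi) := by
      funext z
      rw [hn z, Function.comp, add_sub_cancel_left, mul_div_cancel_left₀ _ (by positivity)]
    rw [this]
    fun_prop
  exact ⟨n 0, fun z => by rw [hn z, PreconnectedSpace.constant inferInstance hc (x := z) (y := 0)]⟩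

theorem isBounded_range_of_periodic {k : ℂ → ℝ} (hk : Continuous k) (h1 : k.Periodic 1)
    (hI : k.Periodic Complex.I) : Bornology.IsBounded (Set.range k) := by
  have hK : IsCompact (Set.Icc (0 : ℝ) 1 ×ℂ Set.Icc (0 : ℝ) 1) :=
    isCompact_Icc.reProdIm isCompact_Icc
  refine (hK.image hk).isBounded.subset ?_
  rintro _ ⟨z, rfl⟩
  refine ⟨z - ⌊z.re⌋ • (1 : ℂ) - ⌊z.im⌋ • Complex.I, ?_, ?_⟩
  · rw [Complex.mem_reProdIm]
    simp [(Int.fract_lt_one _).le]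
  · rw [hI.sub_zsmul_eq, h1.sub_zsmul_eq]

/-- A truly periodic lifted angle is affine, with frequency in twice the dual lattice. -/
theorem exists_affine_of_trulyPeriodic {w : ℂ} (hw : w ≠ 0) {β : ℂ → ℝ}
    (hβ : InnerProductSpace.HarmonicOnNhd β Set.univ)
    (hper : TrulyPeriodic (spanZ w (Complex.I * w)) β) :
    ∃ (p q : ℤ) (c : ℝ), ∀ z, β (w * z) = 4 * Real.pi * (p * z.re + q * z.im) + c := by
  have hc : Continuous β := continuousOn_univ.1 hβ.continuousOn
  obtain ⟨p, hp⟩ := exists_int_of_exp_half_eq hc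
    (hper w (mem_spanZ.2 ⟨1, 0, by simp⟩))
  obtain ⟨q, hq⟩ := exists_int_of_exp_half_eq hc
    (hper (Complex.I * w) (mem_spanZ.2 ⟨0, 1, by simp⟩))
  -- The real part of this holomorphic function has the same increments over the lattice as `β`. The
  -- difference `h` is harmonic and doubly periodic, hence bounded, hence constant.
  let l : ℂ → ℂ := fun ζ => 4 * Real.pi * ((p - q * Complex.I) * (ζ / w))
  have hl : ∀ z, (l (w * z)).re = 4 * Real.pi * (p * z.re + q * z.im) := by
    intro z
    have : l (w * z) = ((4 * Real.pi : ℝ) : ℂ) * ((p - q * Complex.I) * z) := by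
      simp only [l, mul_div_cancel_left₀ _ hw]; push_cast; rfl
    rw [this, Complex.re_ofReal_mul]
    simp
  have hlh : InnerProductSpace.HarmonicOnNhd (fun ζ => (l ζ).re) Set.univ := fun ζ _ =>
    (show AnalyticAt ℂ l ζ by fun_prop (disch := exact hw)).harmonicAt_re
  let h : ℂ → ℝ := β - fun ζ => (l ζ).re
  have hh : InnerProductSpace.HarmonicOnNhd h Set.univ := hβ.sub hlh
  have hk : ∀ z, h (w * z) = β (w * z) - 4 * Real.pi * (p * z.re + q * z.im) := fun z => by
    simp only [h, Pi.sub_apply, hl]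
  have hhc : Continuous h := continuousOn_univ.1 hh.continuousOn
  have hb : Bornology.IsBounded (Set.range fun z => h (w * z)) := by
    refine isBounded_range_of_periodic (hhc.comp (by fun_prop)) (fun z => ?_) fun z => ?_
    · rw [hk, hk, mul_add, mul_one, hp]
      simp; ring
    · rw [hk, hk, mul_add, mul_comm w Complex.I, hq]
      simp; ring
  have hb' : Bornology.IsBounded (Set.range h) := hb.subset <| by
    rintro _ ⟨ζ, rfl⟩
    exact ⟨ζ / w, by simp only [mul_div_cancel₀ _ hw]⟩
  refine ⟨p, q, h 0, fun z => ?_⟩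
  rw [← InnerProductSpace.bounded_harmonic_on_complex_plane_is_constant h hh hb' (w * z) 0, hk]
  ring

/-! ### Invariance of the map under the half diagonal -/

/-- A Hamiltonian stationary map that is periodic with respect to a square lattice, with affine
angle of frequency in twice the dual lattice, is periodic with respect to half the diagonal. -/
theorem IsHamStatLagrangian.periodic_half {f : ℂ → E4} {β : ℂ → ℝ} (h : IsHamStatLagrangian f β)
    {w : ℂ} (h1 : f.Periodic w) (hI : f.Periodic (Complex.I * w)) {p q : ℤ} {c : ℝ}
    (hβ : ∀ z, β (w * z) = 4 * Real.pi * (p * z.re + q * z.im) + c) (hw : w ≠ 0) :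
    f.Periodic ((1 + Complex.I) / 2 * w) := by
  have hfd : Differentiable ℝ f := h.smooth.differentiable (by simp)
  let E : ℂ → ℂ := fun z => Complex.exp (Complex.I * β (w * z))
  let A : ℂ → ℂ := fun z => zOneCLM (f (w * z))
  let C : ℂ → ℂ := fun z => conjZTwoCLM (f (w * z))
  have hfw : ContDiff ℝ 1 fun z => f (w * z) :=
    (h.smooth.of_le (by exact_mod_cast le_top)).comp (contDiff_const.mul contDiff_id)
  have hA : ContDiff ℝ 1 A := zOneCLM.contDiff.comp hfw
  have hC : ContDiff ℝ 1 C := conjZTwoCLM.contDiff.comp hfw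
  have hf1 : ∀ z, f (w * (z + 1)) = f (w * z) := fun z => by rw [mul_add, mul_one, h1]
  have hfI : ∀ z, f (w * (z + Complex.I)) = f (w * z) := fun z => by
    rw [mul_add, mul_comm w Complex.I, hI]
  have hA1 : A.Periodic 1 := fun z => congrArg zOneCLM (hf1 z)
  have hAI : A.Periodic Complex.I := fun z => congrArg zOneCLM (hfI z)
  have hC1 : C.Periodic 1 := fun z => congrArg conjZTwoCLM (hf1 z)
  have hCI : C.Periodic Complex.I := fun z => congrArg conjZTwoCLM (hfI z)
  have hE : ∀ z, E z = Complex.exp (Complex.I * c) * char (2 * p) z.re * char (2 * q) z.im := by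
    intro z
    simp only [E, char, hβ, ← Complex.exp_add]
    congr 1
    push_cast; ring
  have hE0 : ∀ z, E z ≠ 0 := fun z => Complex.exp_ne_zero _
  have hE' : ∀ z, (E z)⁻¹ = (Complex.exp (Complex.I * c))⁻¹ * char (2 * -p) z.re *
      char (2 * -q) z.im := by
    intro z
    rw [hE, mul_inv, mul_inv]
    simp only [char, ← Complex.exp_neg]
    congr 3
    all_goals push_cast; ring
  have sys : ∀ z v : ℂ, fderiv ℝ A z v = E z * fderiv ℝ C z (v * Complex.I) := by
    intro z v
    rw [fderiv_clm_comp_mul_left hfd, fderiv_clm_comp_mul_left hfd, ← mul_assoc]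
    exact apply_eq_mul_apply_mul_I (h.system (w * z)).1 (h.system (w * z)).2 (w * v)
  have s1 : ∀ z, fderiv ℝ A z 1 = E z * fderiv ℝ C z Complex.I := fun z => by
    simpa using sys z 1
  have s2 : ∀ z, fderiv ℝ A z Complex.I = -(E z * fderiv ℝ C z 1) := fun z => by
    simpa using sys z Complex.I
  have hAp := periodic_half_of_system hA hC hA1 hAI hC1 hCI _ p q hE s1 s2
  have hAneg : ∀ z, fderiv ℝ (-A) z = -fderiv ℝ A z := fun z => fderiv_neg
  -- The system is preserved by $(A,C,E)\mapsto(C,-A,E^{-1})$, which replaces the frequency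
  -- $(2p,2q)$ by its negative.
  have hCp := periodic_half_of_system hC hA.neg hC1 hCI (fun z => congrArg Neg.neg (hA1 z))
    (fun z => congrArg Neg.neg (hAI z)) _ (-p) (-q) hE'
    (fun z => by
      change _ = _ * fderiv ℝ (-A) z _
      rw [hAneg, neg_apply, s2, neg_neg, inv_mul_cancel_left₀ (hE0 z)])
    (fun z => by
      change _ = -(_ * fderiv ℝ (-A) z _)
      rw [hAneg, neg_apply, s1, mul_neg, neg_neg, inv_mul_cancel_left₀ (hE0 z)])
  intro z
  have hz : w * (z / w + (1 + Complex.I) / 2) = z + (1 + Complex.I) / 2 * w := by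
    field_simp
  have hz' : w * (z / w) = z := mul_div_cancel₀ _ hw
  rw [← hz]
  conv_rhs => rw [← hz']
  exact E4_ext (hAp (z / w)) (hCp (z / w))

/-! ### The square lattice and its index two extension -/

section Lattice

variable {w : ℂ}

theorem half_add_half_mem_iff {m n : ℤ} (hw : w ≠ 0) :
    ((m : ℂ) / 2 + n / 2 * Complex.I) * w ∈ spanZ w (Complex.I * w) ↔ Even m ∧ Even n := by
  rw [mem_spanZ]
  constructor
  · rintro ⟨a, b, h⟩
    have h' : (m : ℂ) / 2 + n / 2 * Complex.I = a + b * Complex.I :=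
      mul_right_cancel₀ hw (by linear_combination h)
    have hr := congrArg Complex.re h'
    have hi := congrArg Complex.im h'
    simp at hr hi
    refine ⟨⟨a, ?_⟩, ⟨b, ?_⟩⟩
    · have : (m : ℝ) = a + a := by linarith
      exact_mod_cast this
    · have : (n : ℝ) = b + b := by linarith
      exact_mod_cast this
  · rintro ⟨⟨a, rfl⟩, ⟨b, rfl⟩⟩
    exact ⟨a, b, by push_cast; ring⟩

theorem mem_halfLattice_iff {z : ℂ} :
    z ∈ spanZ ((1 - Complex.I) / 2 * w) ((1 + Complex.I) / 2 * w) ↔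
      ∃ m n : ℤ, Even (m + n) ∧ z = ((m : ℂ) / 2 + n / 2 * Complex.I) * w := by
  rw [mem_spanZ]
  constructor
  · rintro ⟨a, b, rfl⟩
    exact ⟨a + b, b - a, ⟨b, by ring⟩, by push_cast; ring⟩
  · rintro ⟨m, n, ⟨k, hk⟩, rfl⟩
    obtain rfl : m = k + k - n := by linarith
    exact ⟨k - n, k, by push_cast; ring⟩

theorem squareLattice_le_halfLattice : spanZ w (Complex.I * w) ≤
    spanZ ((1 - Complex.I) / 2 * w) ((1 + Complex.I) / 2 * w) := by
  intro z hz
  obtain ⟨a, b, rfl⟩ := mem_spanZ.1 hz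
  exact mem_halfLattice_iff.2 ⟨2 * a, 2 * b, ⟨a + b, by ring⟩, by push_cast; ring⟩

theorem isSquareLattice_halfLattice (hw : w ≠ 0) :
    IsSquareLattice (spanZ ((1 - Complex.I) / 2 * w) ((1 + Complex.I) / 2 * w)) := by
  refine ⟨(1 - Complex.I) / 2 * w, mul_ne_zero (fun h => ?_) hw, ?_⟩
  · have := congrArg Complex.re h
    simp at this
  · congr 1
    linear_combination (w / 2) * Complex.I_sq

theorem halfDiagonal_notMem (hw : w ≠ 0) :
    (1 + Complex.I) / 2 * w ∉ spanZ w (Complex.I * w) := by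
  have h := half_add_half_mem_iff (m := 1) (n := 1) hw
  intro hm
  have : ¬ Even (1 : ℤ) := by decide
  refine this (h.1 ?_).1
  convert hm using 1
  push_cast; ring

theorem halfDiagonal_mem : (1 + Complex.I) / 2 * w ∈
    spanZ ((1 - Complex.I) / 2 * w) ((1 + Complex.I) / 2 * w) :=
  mem_spanZ.2 ⟨0, 1, by simp⟩

/-- In half-integer coordinates `m` and `n` have equal parity: both even gives a point of the
smaller lattice, both odd a point of its translate by the half diagonal. -/
theorem mem_or_sub_mem_of_mem_halfLattice (hw : w ≠ 0) {z : ℂ}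
    (hz : z ∈ spanZ ((1 - Complex.I) / 2 * w) ((1 + Complex.I) / 2 * w)) :
    z ∈ spanZ w (Complex.I * w) ∨ z - (1 + Complex.I) / 2 * w ∈ spanZ w (Complex.I * w) := by
  obtain ⟨m, n, hmn, rfl⟩ := mem_halfLattice_iff.1 hz
  by_cases hm : Even m
  · exact .inl ((half_add_half_mem_iff hw).2 ⟨hm, (Int.even_add.1 hmn).1 hm⟩)
  · right
    have hn : ¬ Even n := fun hn => hm ((Int.even_add.1 hmn).2 hn)
    convert (half_add_half_mem_iff (m := m - 1) (n := n - 1) hw).2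
      ⟨(Int.not_even_iff_odd.1 hm).sub_odd odd_one, (Int.not_even_iff_odd.1 hn).sub_odd odd_one⟩ using 1
    push_cast; ring

/-- Closedness makes the quotient torus a $T_1$ space, where finite subsets are discrete. -/
theorem isClosed_squareLattice (hw : w ≠ 0) : IsClosed (spanZ w (Complex.I * w) : Set ℂ) := by
  have : (spanZ w (Complex.I * w) : Set ℂ) =
      (fun z => (z / w).re) ⁻¹' Set.range ((↑) : ℤ → ℝ) ∩
      (fun z => (z / w).im) ⁻¹' Set.range ((↑) : ℤ → ℝ) := by
    ext z
    simp only [SetLike.mem_coe, mem_spanZ, Set.mem_inter_iff, Set.mem_preimage, Set.mem_range]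
    constructor
    · rintro ⟨m, n, rfl⟩
      have : (m * w + n * (Complex.I * w)) / w = m + n * Complex.I := by field_simp
      rw [this]
      exact ⟨⟨m, by simp⟩, ⟨n, by simp⟩⟩
    · rintro ⟨⟨m, hm⟩, ⟨n, hn⟩⟩
      refine ⟨m, n, ?_⟩
      have h := Complex.re_add_im (z / w)
      rw [← hm, ← hn, eq_div_iff hw] at h
      rw [← h]
      push_cast; ring
  rw [this]
  have hZ := Int.isClosedEmbedding_coe_real.isClosed_range
  exact (hZ.preimage (by fun_prop)).inter (hZ.preimage (by fun_prop))

end Lattice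

/-! ### The twofold covering -/

theorem torusProj_mk {Γ Δ : AddSubgroup ℂ} (h : Γ ≤ Δ) (z : ℂ) :
    torusProj h (QuotientAddGroup.mk z) = QuotientAddGroup.mk z := rfl

/-- The projection of tori associated with an inclusion of lattices of index two is a twofold
covering. -/
theorem isTwofoldCover_torusProj {Γ Δ : AddSubgroup ℂ} (h : Γ ≤ Δ) (hΓ : IsClosed (Γ : Set ℂ))
    {d : ℂ} (hd : d ∈ Δ) (hd' : d ∉ Γ) (hΔ : ∀ z ∈ Δ, z ∈ Γ ∨ z - d ∈ Γ) :
    IsTwofoldCover (torusProj h) := by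
  have hfib : ∀ z : ℂ, torusProj h ⁻¹' {QuotientAddGroup.mk z} =
      {QuotientAddGroup.mk z, QuotientAddGroup.mk (z + d)} := by
    intro z
    ext x
    induction x using QuotientAddGroup.induction_on with | _ x => ?_
    simp only [Set.mem_preimage, torusProj_mk, Set.mem_singleton_iff, Set.mem_insert_iff]
    rw [eq_comm, QuotientAddGroup.eq, eq_comm (b := (z : ℂ ⧸ Γ)), QuotientAddGroup.eq,
      eq_comm (b := ((z + d : ℂ) : ℂ ⧸ Γ)), QuotientAddGroup.eq]
    have hx : -(z + d) + x = -z + x - d := by ring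
    rw [hx]
    refine ⟨hΔ _, fun hx => hx.elim (fun hx => h hx) fun hx => ?_⟩
    simpa using Δ.add_mem (h hx) hd
  have hcard : ∀ b, (torusProj h ⁻¹' {b}).ncard = 2 := by
    intro b
    induction b using QuotientAddGroup.induction_on with | _ z => ?_
    rw [hfib, Set.ncard_pair]
    rw [Ne, QuotientAddGroup.eq]
    simpa using hd'
  refine ⟨?_, hcard⟩
  have hq : Topology.IsQuotientMap (torusProj h) :=
    Topology.IsQuotientMap.of_comp (f := (QuotientAddGroup.mk : ℂ → ℂ ⧸ Γ))
      continuous_quotient_mk'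
      (continuous_quot_lift _ (continuous_quotient_mk'))
      isQuotientMap_quotient_mk'
  have : T1Space (ℂ ⧸ Γ) := inferInstance
  let π : ℂ ⧸ Γ →+ ℂ ⧸ Δ := QuotientAddGroup.map Γ Δ (AddMonoidHom.id ℂ) h
  -- The kernel is the fibre over zero, with two points. Being discrete, it makes the quotient
  -- homomorphism a covering.
  have hfin : (π.ker : Set (ℂ ⧸ Γ)).Finite := Set.finite_of_ncard_ne_zero (by
    rw [show (π.ker : Set (ℂ ⧸ Γ)) = torusProj h ⁻¹' {0} from rfl, hcard]
    exact two_ne_zero)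
  exact (hq.isAddQuotientCoveringMap_of_isDiscrete_ker_addMonoidHom (f := π)
    hfin.isDiscrete).isCoveringMap

end HSL

/-! ### The main theorem -/

theorem mainTheorem11 (w : ℂ) (hw : w ≠ 0) (Γ Δ : AddSubgroup ℂ)
    (hΓ : Γ = HSL.spanZ w (Complex.I * w))
    (hΔ : Δ = HSL.spanZ ((1 - Complex.I) / 2 * w) ((1 + Complex.I) / 2 * w))
    (X : ℂ ⧸ Γ → HSL.E4) (β : ℂ → ℝ)
    (hX : HSL.IsSolution Γ X β) (hper : HSL.TrulyPeriodic Γ β) :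
    (∀ δ ∈ Δ, ∀ z : ℂ, HSL.lift X (z + δ) = HSL.lift X z) ∧
    HSL.IsSquareLattice Δ ∧
    ∃ h : Γ ≤ Δ, HSL.IsTwofoldCover (HSL.torusProj h) ∧
      ∃ Y : ℂ ⧸ Δ → HSL.E4, HSL.IsSolution Δ Y β ∧ X = Y ∘ HSL.torusProj h := by
  subst hΓ hΔ
  obtain ⟨p, q, c, hβ⟩ := HSL.exists_affine_of_trulyPeriodic hw hX.hamStat.harmonic hper
  have hlift : ∀ γ ∈ HSL.spanZ w (Complex.I * w), (HSL.lift X).Periodic γ := fun γ hγ z =>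
    congrArg X (QuotientAddGroup.mk_add_of_mem z hγ)
  have hhalf : (HSL.lift X).Periodic ((1 + Complex.I) / 2 * w) :=
    hX.hamStat.periodic_half (hlift _ (HSL.mem_spanZ.2 ⟨1, 0, by simp⟩))
      (hlift _ (HSL.mem_spanZ.2 ⟨0, 1, by simp⟩)) hβ hw
  have hinv : ∀ δ ∈ HSL.spanZ ((1 - Complex.I) / 2 * w) ((1 + Complex.I) / 2 * w),
      ∀ z : ℂ, HSL.lift X (z + δ) = HSL.lift X z := by
    intro δ hδ z
    rcases HSL.mem_or_sub_mem_of_mem_halfLattice hw hδ with h | h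
    · exact hlift _ h z
    · have := (hlift _ h).add_period hhalf z
      rwa [sub_add_cancel] at this
  refine ⟨hinv, HSL.isSquareLattice_halfLattice hw, HSL.squareLattice_le_halfLattice,
    HSL.isTwofoldCover_torusProj _ (HSL.isClosed_squareLattice hw) HSL.halfDiagonal_mem
      (HSL.halfDiagonal_notMem hw) fun z hz => HSL.mem_or_sub_mem_of_mem_halfLattice hw hz, ?_⟩
  let Y : ℂ ⧸ HSL.spanZ ((1 - Complex.I) / 2 * w) ((1 + Complex.I) / 2 * w) → HSL.E4 :=
    fun x => Quotient.liftOn' x (HSL.lift X) fun a b hab => by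
      rw [QuotientAddGroup.leftRel_apply] at hab
      have := hinv _ hab a
      rwa [add_neg_cancel_left, eq_comm] at this
  -- The lift of `Y` is by definition the lift of `X`, so only the periodicity of $e^{i\beta}$ under
  -- the larger lattice has to be checked.
  refine ⟨Y, ⟨hX.hamStat, fun γ hγ z => ?_⟩, ?_⟩
  · obtain ⟨m, n, ⟨k, hk⟩, rfl⟩ := HSL.mem_halfLattice_iff.1 hγ
    have hz : z + ((m : ℂ) / 2 + n / 2 * Complex.I) * w =
        w * (z / w + ((m / 2 : ℝ) + (n / 2 : ℝ) * Complex.I)) := by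
      push_cast; field_simp
    have hz' : w * (z / w) = z := mul_div_cancel₀ _ hw
    -- Half-integer coordinates turn the factor $4\pi$ into $2\pi$: $e^{i\beta}$ is unchanged,
    -- whereas $e^{i\beta/2}$ acquires the sign $(-1)^{pm+qn}$.
    have hb : β (z + ((m : ℂ) / 2 + n / 2 * Complex.I) * w) =
        β z + (p * m + q * n : ℤ) * (2 * Real.pi) := by
      conv_rhs => rw [← hz', hβ]
      rw [hz, hβ]
      simp
      ring
    rw [hb]
    have : Complex.I * ((β z + (p * m + q * n : ℤ) * (2 * Real.pi) : ℝ) : ℂ) =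
        Complex.I * β z + (p * m + q * n : ℤ) * (2 * Real.pi * Complex.I) := by
      push_cast; ring
    rw [this, Complex.exp_add, Complex.exp_int_mul_two_pi_mul_I, mul_one]
  · funext x
    induction x using QuotientAddGroup.induction_on with | _ x => rfl
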